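/- Theorem. Let $S$ be a finite set, let $P$ be a stochastic matrix on $S$ and let $g:S\times S\to\mathbb{R}$ (a finite Markov reward process with transition-based reward $g$). Suppose that the chain is unichain, i.e. it has exactly one recurrent class (transient states are allowed), and aperiodic, i.e. every recurrent state has period $1$. Let $\mu_0$ be any probability distribution on $S$, and let $(X^{(j)}_t)_{t\ge 0}$, $j=0,1,2,\dots$, be independent Markov chains with transition matrix $P$ and initial distribution $\mu_0$, defined on one probability space. Put $r^{(j)}_t=g(X^{(j)}_t,X^{(j)}_{t+1})$. Then the reward process is asymptotically ergodic: for every trajectory $i$, almost surely, all the following limits exist and $$\lim_{t\to\infty}\ \lim_{N\to\infty}\frac1N\sum_{j=0}^{N} r^{(j)}_t\;=\;\lim_{T\to\infty}\frac1T\sum_{\kappa=0}^{T} r^{(i)}_\kappa .$$ Moreover, $P$ has a unique stationary distribution $\pi$ and, with $\rho=\sum_{s,s'}\pi(s)P(s,s')g(s,s')$, one has $\mathbb{E}[r^{(i)}_t]\to\rho$ as $t\to\infty$ for every $i$; the time average along every trajectory $i$ converges to $\rho$ almost surely; and the ensemble average $\frac1N\sum_{j=0}^{N} r^{(j)}_t$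 converges to $\rho$ in probability as $N$ and $t$ tend to infinity simultaneously (as a double limit). -/

import Mathlib

open Filter Topology MeasureTheory ProbabilityTheory
open scoped Matrix

/-- A Markov reward process on a finite state space `S`: a time-homogeneous Markov chain, given by
its transition matrix, together with a deterministic reward for each transition. -/
structure MarkovRewardProcess (S : Type*) [Fintype S] [DecidableEq S] where
  /-- `P s s'` is the probability of moving from `s` to `s'` in one step. -/
  P : Matrix S S ℝ
  /-- The entries of `P` are nonnegative and every row sums to one. -/
  stochastic : P ∈ Matrix.rowStochastic ℝ S
  /-- `g s s'` is the reward received on the transition from `s` to `s'`. -/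
  g : S → S → ℝ

namespace FiniteChain

variable {S : Type*} [Fintype S] [DecidableEq S]

/-- `s'` can be reached from `s` in some number (possibly zero) of steps. -/
def Accessible (P : Matrix S S ℝ) (s s' : S) : Prop :=
  ∃ n : ℕ, 0 < (P ^ n) s s'

/-- The communicating class of `s`. -/
def commClass (P : Matrix S S ℝ) (s : S) : Set S :=
  {s' | Accessible P s s' ∧ Accessible P s' s}

/-- Recurrence of a state of a finite chain: the chain can return to `s` from wherever it can get
to from `s`. -/
def IsRecurrent (P : Matrix S S ℝ) (s : S) : Prop :=
  ∀ s', Accessible P s s' → Accessible P s' s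

/-- A recurrent class is the communicating class of a recurrent state. -/
def IsRecurrentClass (P : Matrix S S ℝ) (C : Set S) : Prop :=
  ∃ s, IsRecurrent P s ∧ C = commClass P s

/-- A chain is unichain if it has exactly one recurrent class (and possibly transient states). -/
def IsUnichain (P : Matrix S S ℝ) : Prop :=
  ∃! C : Set S, IsRecurrentClass P C

/-- The period of a state: the greatest common divisor of its possible return times. -/
noncomputable def period (P : Matrix S S ℝ) (s : S) : ℕ :=
  Nat.setGcd {n : ℕ | 1 ≤ n ∧ 0 < (P ^ n) s s}

/-- A chain is aperiodic if its recurrent states have period one. Transient states, which the chain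
visits only finitely often, are not restricted. -/
def IsAperiodic (P : Matrix S S ℝ) : Prop :=
  ∀ s, IsRecurrent P s → period P s = 1

/-- `π` is a stationary probability distribution of `P`. -/
def IsStationary (P : Matrix S S ℝ) (π : S → ℝ) : Prop :=
  π ∈ stdSimplex ℝ S ∧ π ᵥ* P = π

/-- `X` is a Markov chain on the probability space `(Ω, μ)` with initial distribution `μ₀` and
transition matrix `P`, that is, its paths have the corresponding finite-dimensional distributions. -/
structure IsMarkovChain {Ω : Type*} [MeasurableSpace Ω] [MeasurableSpace S] (μ : Measure Ω)
    (μ₀ : S → ℝ) (P : Matrix S S ℝ) (X : ℕ → Ω → S) : Prop where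
  measurable : ∀ t, Measurable (X t)
  law : ∀ (n : ℕ) (x : ℕ → S), μ.real {ω | ∀ k ≤ n, X k ω = x k} =
    μ₀ (x 0) * ∏ k ∈ Finset.range n, P (x k) (x (k + 1))

end FiniteChain

/-- The reward collected at time `t` of trajectory `j`, on the transition from time `t` to `t + 1`. -/
def MarkovRewardProcess.reward {S : Type*} [Fintype S] [DecidableEq S] (M : MarkovRewardProcess S)
    {Ω : Type*} (X : ℕ → ℕ → Ω → S) (j t : ℕ) (ω : Ω) : ℝ :=
  M.g (X j t ω) (X j (t + 1) ω)

/-- The expected one-step reward `∑ π(s) P(s,s') g(s,s')` when the state is distributed as `π`. -/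
def MarkovRewardProcess.meanReward {S : Type*} [Fintype S] [DecidableEq S]
    (M : MarkovRewardProcess S) (π : S → ℝ) : ℝ :=
  ∑ s, ∑ s', π s * M.P s s' * M.g s s'

/-- The average over trajectories `0, …, N` of the rewards received at time `t`. -/
noncomputable def ensembleAverage {Ω : Type*} (r : ℕ → ℕ → Ω → ℝ) (N t : ℕ) (ω : Ω) : ℝ :=
  (1 / (N : ℝ)) * ∑ j ∈ Finset.range (N + 1), r j t ω

/-- The average over times `0, …, T` of the rewards received along trajectory `i`. -/
noncomputable def timeAverage {Ω : Type*} (r : ℕ → ℕ → Ω → ℝ) (i T : ℕ) (ω : Ω) : ℝ :=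
  (1 / (T : ℝ)) * ∑ κ ∈ Finset.range (T + 1), r i κ ω

/-- Asymptotic ergodicity of a reward process `r`, where `r j t` is the reward at time `t` of
trajectory `j`. For every trajectory `i`, almost surely, the following limits exist and the last two
agree: at each time `t` the ensemble averages converge as the number of trajectories grows, their
limits `e t` converge as `t → ∞`, and the time averages along trajectory `i` converge.

The infinite-ensemble limit is taken at each time before `t → ∞`. (A simultaneous almost sure limit
in `N` and `t` does not exist even for independent fair coin flips: for each `N` there are almost
surely arbitrarily late times at which the first `N + 1` trajectories all show heads.) -/
def IsAsymptoticallyErgodic {Ω : Type*} [MeasurableSpace Ω] (μ : Measure Ω)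
    (r : ℕ → ℕ → Ω → ℝ) : Prop :=
  ∀ i : ℕ, ∀ᵐ ω ∂μ, ∃ (e : ℕ → ℝ) (ρ : ℝ),
    (∀ t, Tendsto (fun N => ensembleAverage r N t ω) atTop (𝓝 (e t))) ∧
    Tendsto e atTop (𝓝 ρ) ∧
    Tendsto (fun T => timeAverage r i T ω) atTop (𝓝 ρ)

/-!
Everything rests on the convergence of the powers of the transition matrix. From every state some
recurrent state can be reached, so in a unichain every state reaches the unique recurrent class; an
aperiodic state of that class has all large integers among its return times, and hence some power
`P ^ m` has a column bounded below by a `δ > 0` (`FiniteChain.exists_pow_column_pos`). Such a power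
contracts the range of a function by the factor `1 - δ`, so the rows of `P ^ n` converge to a common
vector `π` (`FiniteChain.exists_tendsto_pow`). This `π` is stationary, no other distribution is, and
expectations at time `t` converge to expectations under `π`.

For the time averages, let `f s = ∑ s', P s s' * g s s'` be the conditional mean reward. Truncating
the Green function after `m` terms gives an approximate solution `h = ∑ i < m, P ^ i f` of the
Poisson equation, `h - P h = f - P ^ m f`. With it the sum of the rewards becomes a sum of bounded
martingale differences, a telescoping term, and the sum of `P ^ m f` along the path
(`FiniteChain.sum_range_eq_sum_correctedReward`). Averages of the martingale differences tend to
zero by a second-moment strong law (`ae_tendsto_average_of_orthogonal`), and `P ^ m f` is uniformly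
close to the mean reward for large `m`; no rate of convergence is needed. The Markov property enters
through `FiniteChain.IsMarkovChain.integral_initialSegment_mul`, which is read off from the
finite-dimensional distributions.

The ensemble limits at a fixed time follow from the strong law of large numbers for independent
identically distributed variables. For the double limit in probability, Chebyshev's inequality
bounds the deviation of the ensemble average uniformly in time
(`tendstoInMeasure_ensembleAverage`).
-/

namespace FiniteChain

/-! ### Accessibility and regularity of the transition matrix -/

section Matrix

variable {S : Type*} [Fintype S] [DecidableEq S] {P : Matrix S S ℝ}

lemma pow_nonneg_apply (hP : P ∈ Matrix.rowStochastic ℝ S) (n : ℕ) (s s' : S) :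
    0 ≤ (P ^ n) s s' :=
  Matrix.nonneg_of_mem_rowStochastic (pow_mem hP n)

lemma pow_add_apply_pos (hP : P ∈ Matrix.rowStochastic ℝ S) {m n : ℕ} {a b c : S}
    (hab : 0 < (P ^ m) a b) (hbc : 0 < (P ^ n) b c) : 0 < (P ^ (m + n)) a c := by
  rw [pow_add, Matrix.mul_apply]
  exact Finset.sum_pos'
    (fun _ _ => mul_nonneg (pow_nonneg_apply hP _ _ _) (pow_nonneg_apply hP _ _ _))
    ⟨b, Finset.mem_univ b, mul_pos hab hbc⟩

lemma Accessible.refl (P : Matrix S S ℝ) (s : S) : Accessible P s s :=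
  ⟨0, by simp⟩

lemma Accessible.trans (hP : P ∈ Matrix.rowStochastic ℝ S) {a b c : S}
    (hab : Accessible P a b) (hbc : Accessible P b c) : Accessible P a c := by
  obtain ⟨m, hm⟩ := hab
  obtain ⟨n, hn⟩ := hbc
  exact ⟨m + n, pow_add_apply_pos hP hm hn⟩

/-- In a finite chain a recurrent state can be reached from everywhere: a state accessible from `s`
with as few accessible states as possible is recurrent. -/
lemma exists_accessible_isRecurrent (hP : P ∈ Matrix.rowStochastic ℝ S) (s : S) :
    ∃ s', Accessible P s s' ∧ IsRecurrent P s' := by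
  obtain ⟨s', hs', hmin⟩ := Set.exists_min_image {a | Accessible P s a}
    (fun a => {b | Accessible P a b}.ncard) (Set.toFinite _) ⟨s, Accessible.refl P s⟩
  refine ⟨s', hs', fun a ha => ?_⟩
  have hsub : {b | Accessible P a b} ⊆ {b | Accessible P s' b} := fun b hb => ha.trans hP hb
  have heq := Set.eq_of_subset_of_ncard_le hsub (hmin a (hs'.trans hP ha)) (Set.toFinite _)
  exact (heq ▸ Accessible.refl P s' : s' ∈ {b | Accessible P a b})

/-- The return times of an aperiodic state form an additive semigroup with greatest common divisor
one, so they contain all large times. -/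
lemma exists_forall_ge_return_pos (hP : P ∈ Matrix.rowStochastic ℝ S) {s : S}
    (hs : period P s = 1) : ∃ n₀, ∀ n ≥ n₀, 0 < (P ^ n) s s := by
  obtain ⟨n₀, hn₀⟩ := Nat.exists_mem_closure_of_ge {n : ℕ | 1 ≤ n ∧ 0 < (P ^ n) s s}
  refine ⟨n₀, fun n hn => ?_⟩
  have hmem := hn₀ n hn (by
    change period P s ∣ n
    simp [hs])
  clear hn
  induction hmem using AddSubmonoid.closure_induction with
  | mem x hx => exact hx.2
  | zero => simp
  | add x y _ _ hx hy => exact pow_add_apply_pos hP hx hy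

/-- Doeblin's condition: for a unichain aperiodic chain there are a time at which, and a state in
which, the chain is with probability bounded below uniformly in the starting state. -/
lemma exists_pow_column_pos [Nonempty S] (hP : P ∈ Matrix.rowStochastic ℝ S)
    (huni : IsUnichain P) (haper : IsAperiodic P) :
    ∃ (m : ℕ) (s₀ : S) (δ : ℝ), 0 < δ ∧ ∀ s, δ ≤ (P ^ m) s s₀ := by
  obtain ⟨C, ⟨s₀, hrec, rfl⟩, hC⟩ := huni
  have hacc : ∀ s, Accessible P s s₀ := fun s => by
    obtain ⟨s', hs', hrec'⟩ := exists_accessible_isRecurrent hP s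
    have hmem : s' ∈ commClass P s₀ :=
      hC _ ⟨s', hrec', rfl⟩ ▸ (⟨Accessible.refl P s', Accessible.refl P s'⟩ : s' ∈ commClass P s')
    exact hs'.trans hP hmem.2
  choose k hk using hacc
  obtain ⟨n₀, hn₀⟩ := exists_forall_ge_return_pos hP (haper s₀ hrec)
  -- One time for all starting states: reach `s₀` from `s` in `k s` steps, and spend the remaining
  -- steps, at least `n₀` of them, on a return to `s₀`.
  have hpos : ∀ s, 0 < (P ^ (n₀ + ∑ a, k a)) s s₀ := fun s => by
    have hle : k s ≤ ∑ a, k a := Finset.single_le_sum (fun _ _ => Nat.zero_le _) (Finset.mem_univ s)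
    have h := pow_add_apply_pos hP (hk s) (hn₀ (n₀ + (∑ a, k a - k s)) (by omega))
    rwa [show k s + (n₀ + (∑ a, k a - k s)) = n₀ + ∑ a, k a by omega] at h
  obtain ⟨s₁, hs₁⟩ := Finite.exists_min fun s => (P ^ (n₀ + ∑ a, k a)) s s₀
  exact ⟨_, s₀, _, hpos s₁, hs₁⟩

/-! ### Convergence of the powers of the transition matrix -/

lemma mulVec_mem_Icc {Q : Matrix S S ℝ} (hQ : Q ∈ Matrix.rowStochastic ℝ S) {f : S → ℝ} {a b : ℝ}
    (hf : ∀ s, f s ∈ Set.Icc a b) (s : S) : (Q *ᵥ f) s ∈ Set.Icc a b := by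
  have hsum := Matrix.sum_row_of_mem_rowStochastic hQ s
  have hconst : ∀ c : ℝ, ∑ t, Q s t * c = c := fun c => by rw [← Finset.sum_mul, hsum, one_mul]
  simp only [Matrix.mulVec, dotProduct]
  constructor
  · rw [← hconst a]
    exact Finset.sum_le_sum fun t _ =>
      mul_le_mul_of_nonneg_left (hf t).1 (Matrix.nonneg_of_mem_rowStochastic hQ)
  · rw [← hconst b]
    exact Finset.sum_le_sum fun t _ =>
      mul_le_mul_of_nonneg_left (hf t).2 (Matrix.nonneg_of_mem_rowStochastic hQ)

/-- A stochastic matrix with a column bounded below by `δ` contracts the range of a function by the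
factor `1 - δ`. -/
lemma exists_mulVec_mem_Icc_contract {Q : Matrix S S ℝ} (hQ : Q ∈ Matrix.rowStochastic ℝ S)
    {s₀ : S} {δ : ℝ} (hδ : ∀ s, δ ≤ Q s s₀) {f : S → ℝ} {a b : ℝ}
    (hf : ∀ s, f s ∈ Set.Icc a b) :
    ∃ a' b', b' - a' = (1 - δ) * (b - a) ∧ ∀ s, (Q *ᵥ f) s ∈ Set.Icc a' b' := by
  refine ⟨δ * f s₀ + (1 - δ) * a, δ * f s₀ + (1 - δ) * b, by ring, fun s => ?_⟩
  have hsum := Matrix.sum_row_of_mem_rowStochastic hQ s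
  have hconst : ∀ c : ℝ, (Q *ᵥ f) s = c + ∑ t, Q s t * (f t - c) := fun c => by
    simp only [Matrix.mulVec, dotProduct, mul_sub, Finset.sum_sub_distrib, ← Finset.sum_mul, hsum]
    ring
  have hnn : ∀ t, 0 ≤ Q s t := fun t => Matrix.nonneg_of_mem_rowStochastic hQ
  constructor
  · have h₁ : Q s s₀ * (f s₀ - a) ≤ ∑ t, Q s t * (f t - a) :=
      Finset.single_le_sum (f := fun t => Q s t * (f t - a))
        (fun t _ => mul_nonneg (hnn t) (sub_nonneg.2 (hf t).1)) (Finset.mem_univ s₀)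
    have h₂ := mul_le_mul_of_nonneg_right (hδ s) (sub_nonneg.2 (hf s₀).1)
    rw [hconst a]
    linarith
  · have h₁ : Q s s₀ * (b - f s₀) ≤ ∑ t, Q s t * (b - f t) :=
      Finset.single_le_sum (f := fun t => Q s t * (b - f t))
        (fun t _ => mul_nonneg (hnn t) (sub_nonneg.2 (hf t).2)) (Finset.mem_univ s₀)
    have h₂ := mul_le_mul_of_nonneg_right (hδ s) (sub_nonneg.2 (hf s₀).2)
    have h₃ : ∑ t, Q s t * (f t - b) = -∑ t, Q s t * (b - f t) := by
      rw [← Finset.sum_neg_distrib]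
      exact Finset.sum_congr rfl fun t _ => by ring
    rw [hconst b, h₃]
    linarith

/-- Under Doeblin's condition, `P ^ n *ᵥ f` converges to a constant function. -/
lemma exists_tendsto_pow_mulVec [Nonempty S] (hP : P ∈ Matrix.rowStochastic ℝ S) {m : ℕ} {s₀ : S}
    {δ : ℝ} (hδ₀ : 0 < δ) (hδ : ∀ s, δ ≤ (P ^ m) s s₀) (f : S → ℝ) :
    ∃ c, ∀ s, Tendsto (fun n => (P ^ n *ᵥ f) s) atTop (𝓝 c) := by
  obtain ⟨lo, hlo⟩ := Finite.exists_min f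
  obtain ⟨hi, hhi⟩ := Finite.exists_max f
  have hblock : ∀ n : ℕ, ∃ a b, b - a = (1 - δ) ^ n * (f hi - f lo) ∧
      ∀ k ≥ n * m, ∀ s, (P ^ k *ᵥ f) s ∈ Set.Icc a b := by
    have hlater : ∀ (n : ℕ) (a b : ℝ), (∀ s, (P ^ n *ᵥ f) s ∈ Set.Icc a b) →
        ∀ k ≥ n, ∀ s, (P ^ k *ᵥ f) s ∈ Set.Icc a b := fun n a b h k hk s => by
      rw [← Nat.sub_add_cancel hk, pow_add, ← Matrix.mulVec_mulVec]
      exact mulVec_mem_Icc (pow_mem hP _) h s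
    intro n
    induction n with
    | zero =>
      exact ⟨f lo, f hi, by simp, hlater _ _ _ (by simpa using fun s => ⟨hlo s, hhi s⟩)⟩
    | succ n ih =>
      obtain ⟨a, b, hab, h⟩ := ih
      obtain ⟨a', b', hab', h'⟩ := exists_mulVec_mem_Icc_contract (pow_mem hP m) hδ (h _ le_rfl)
      refine ⟨a', b', by rw [hab', hab]; ring, hlater _ _ _ fun s => ?_⟩
      rw [show (n + 1) * m = m + n * m by ring, pow_add, ← Matrix.mulVec_mulVec]
      exact h' s
  have hδ₁ : δ ≤ 1 := (hδ s₀).trans (Matrix.le_one_of_mem_rowStochastic (pow_mem hP m))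
  have hzero : Tendsto (fun n : ℕ => (1 - δ) ^ n * (f hi - f lo)) atTop (𝓝 0) := by
    simpa using (tendsto_pow_atTop_nhds_zero_of_lt_one (by linarith) (by linarith)).mul_const
      (f hi - f lo)
  have hclose : ∀ ε > 0, ∃ N, ∀ k ≥ N, ∀ l ≥ N, ∀ s s',
      |(P ^ k *ᵥ f) s - (P ^ l *ᵥ f) s'| < ε := fun ε hε => by
    obtain ⟨n, hn⟩ := (hzero.eventually (gt_mem_nhds hε)).exists
    obtain ⟨a, b, hab, h⟩ := hblock n
    refine ⟨n * m, fun k hk l hl s s' => ?_⟩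
    have h₁ := h k hk s
    have h₂ := h l hl s'
    rw [abs_lt]
    constructor <;> linarith [h₁.1, h₁.2, h₂.1, h₂.2]
  obtain ⟨c, hc⟩ := cauchySeq_tendsto_of_complete
    (Metric.cauchySeq_iff.2 fun ε hε => by
      obtain ⟨N, hN⟩ := hclose ε hε
      exact ⟨N, fun k hk l hl => hN k hk l hl lo lo⟩ : CauchySeq fun n => (P ^ n *ᵥ f) lo)
  refine ⟨c, fun s => ?_⟩
  have hdiff : Tendsto (fun n => (P ^ n *ᵥ f) s - (P ^ n *ᵥ f) lo) atTop (𝓝 0) :=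
    Metric.tendsto_atTop.2 fun ε hε => by
      obtain ⟨N, hN⟩ := hclose ε hε
      exact ⟨N, fun k hk => by simpa [Real.dist_eq] using hN k hk k hk s lo⟩
  simpa using hdiff.add hc

/-- The powers of the transition matrix of a unichain aperiodic chain converge to a matrix all of
whose rows are the same. -/
lemma exists_tendsto_pow [Nonempty S] (hP : P ∈ Matrix.rowStochastic ℝ S)
    (huni : IsUnichain P) (haper : IsAperiodic P) :
    ∃ π : S → ℝ, ∀ s s', Tendsto (fun n => (P ^ n) s s') atTop (𝓝 (π s')) := by
  obtain ⟨m, s₀, δ, hδ₀, hδ⟩ := exists_pow_column_pos hP huni haper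
  choose π hπ using fun s' => exists_tendsto_pow_mulVec hP hδ₀ hδ (Pi.single s' 1)
  exact ⟨π, fun s s' => by simpa using hπ s' s⟩

variable {π : S → ℝ}

lemma tendsto_pow_mulVec (hπ : ∀ s s', Tendsto (fun n => (P ^ n) s s') atTop (𝓝 (π s')))
    (f : S → ℝ) (s : S) : Tendsto (fun n => (P ^ n *ᵥ f) s) atTop (𝓝 (π ⬝ᵥ f)) :=
  tendsto_finsetSum _ fun s' _ => (hπ s s').mul_const (f s')

lemma tendsto_vecMul_pow (hπ : ∀ s s', Tendsto (fun n => (P ^ n) s s') atTop (𝓝 (π s')))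
    {ν : S → ℝ} (hν : ∑ s, ν s = 1) (s' : S) :
    Tendsto (fun n => (ν ᵥ* P ^ n) s') atTop (𝓝 (π s')) := by
  have h : Tendsto (fun n => ∑ s, ν s * (P ^ n) s s') atTop (𝓝 (∑ s, ν s * π s')) :=
    tendsto_finsetSum _ fun s _ => (hπ s s').const_mul (ν s)
  rwa [← Finset.sum_mul, hν, one_mul] at h

lemma isStationary_of_tendsto_pow [Nonempty S] (hP : P ∈ Matrix.rowStochastic ℝ S)
    (hπ : ∀ s s', Tendsto (fun n => (P ^ n) s s') atTop (𝓝 (π s'))) : IsStationary P π := by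
  inhabit S
  refine ⟨⟨fun s' => ge_of_tendsto' (hπ default s') fun n => pow_nonneg_apply hP n _ _, ?_⟩, ?_⟩
  · refine tendsto_nhds_unique (tendsto_finsetSum _ fun s' _ => hπ default s') ?_
    simp [Matrix.sum_row_of_mem_rowStochastic (pow_mem hP _)]
  · ext s'
    refine tendsto_nhds_unique
      (tendsto_finsetSum _ fun s _ => (hπ default s).mul_const (P s s')) ?_
    simpa [pow_succ, Matrix.mul_apply] using (tendsto_add_atTop_iff_nat 1).2 (hπ default s')

lemma IsStationary.vecMul_pow (h : IsStationary P π) (n : ℕ) : π ᵥ* P ^ n = π := by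
  induction n with
  | zero => simp
  | succ n ih => rw [pow_succ, ← Matrix.vecMul_vecMul, ih, h.2]

lemma IsStationary.eq_of_tendsto_pow {π' : S → ℝ} (h : IsStationary P π')
    (hπ : ∀ s s', Tendsto (fun n => (P ^ n) s s') atTop (𝓝 (π s'))) : π' = π := by
  ext s'
  exact tendsto_nhds_unique (by simp [h.vecMul_pow]) (tendsto_vecMul_pow hπ h.1.2 s')

end Matrix

end FiniteChain

namespace FiniteChain

/-! ### Expectations along a Markov chain -/

section Paths

variable {S : Type*} {Ω : Type*}

/-- The initial segment `X 0 ω, …, X n ω` of a path. -/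
def initialSegment (X : ℕ → Ω → S) (n : ℕ) (ω : Ω) : Fin (n + 1) → S :=
  fun k => X k ω

variable [MeasurableSpace S] [MeasurableSpace Ω]
  {μ : Measure Ω} {μ₀ : S → ℝ} {P : Matrix S S ℝ} {X : ℕ → Ω → S}

lemma measurable_initialSegment (hX : IsMarkovChain μ μ₀ P X) (n : ℕ) :
    Measurable (initialSegment X n) :=
  measurable_pi_lambda _ fun _ => hX.measurable _

lemma IsMarkovChain.measureReal_initialSegment_zero (hX : IsMarkovChain μ μ₀ P X)
    (y : Fin 1 → S) : μ.real (initialSegment X 0 ⁻¹' {y}) = μ₀ (y 0) := by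
  have h := hX.law 0 fun _ => y 0
  simp only [Finset.range_zero, Finset.prod_empty, mul_one] at h
  rw [← h]
  congr 1
  ext ω
  simp [initialSegment, funext_iff]

/-- The one-step form of the law of a Markov chain: a segment is prolonged by the state `b` with
the transition probability from its last state. -/
lemma IsMarkovChain.measureReal_initialSegment_snoc (hX : IsMarkovChain μ μ₀ P X) (n : ℕ)
    (y : Fin (n + 1) → S) (b : S) :
    μ.real (initialSegment X (n + 1) ⁻¹' {(Fin.snoc y b : Fin (n + 2) → S)}) =
      μ.real (initialSegment X n ⁻¹' {y}) * P (y (Fin.last n)) b := by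
  -- Any extension of the segment to an infinite sequence serves in the law; this one is `b` from
  -- time `n + 1` on.
  let x : ℕ → S := fun k => if h : k < n + 1 then y ⟨k, h⟩ else b
  have hset : ∀ ω, (∀ k ≤ n, X k ω = x k) ↔ initialSegment X n ω = y := fun ω => by
    simp only [funext_iff, initialSegment, Fin.forall_iff, x]
    refine forall_congr' fun k => ?_
    constructor
    · intro h hk
      simpa [hk] using h (by omega)
    · intro h hk
      simpa [show k < n + 1 by omega] using h (by omega)
  have hset' : ∀ ω, (∀ k ≤ n + 1, X k ω = x k) ↔
      initialSegment X (n + 1) ω = (Fin.snoc y b : Fin (n + 2) → S) := fun ω => by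
    simp only [funext_iff, initialSegment, Fin.forall_iff, x]
    refine forall_congr' fun k => ?_
    simp only [Fin.snoc, Fin.castLT]
    constructor
    · intro h hk
      simpa using h (by omega)
    · intro h hk
      simpa using h (by omega)
  have h₀ := hX.law n x
  have h₁ := hX.law (n + 1) x
  rw [Finset.prod_range_succ, ← mul_assoc, ← h₀] at h₁
  simp only [hset, hset'] at h₁
  simpa [x, Set.preimage, Fin.last] using h₁

lemma IsMarkovChain.measureReal_initialSegment_eq {X' : ℕ → Ω → S}
    (hX : IsMarkovChain μ μ₀ P X) (hX' : IsMarkovChain μ μ₀ P X') (n : ℕ) (y : Fin (n + 1) → S) :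
    μ.real (initialSegment X n ⁻¹' {y}) = μ.real (initialSegment X' n ⁻¹' {y}) := by
  induction n with
  | zero => rw [hX.measureReal_initialSegment_zero, hX'.measureReal_initialSegment_zero]
  | succ n ih =>
    rw [← Fin.snoc_init_self y, hX.measureReal_initialSegment_snoc,
      hX'.measureReal_initialSegment_snoc, ih]

variable [Fintype S] [MeasurableSingletonClass S] [IsProbabilityMeasure μ]

lemma IsMarkovChain.identDistrib_initialSegment {X' : ℕ → Ω → S}
    (hX : IsMarkovChain μ μ₀ P X) (hX' : IsMarkovChain μ μ₀ P X') (n : ℕ) :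
    IdentDistrib (initialSegment X n) (initialSegment X' n) μ μ where
  aemeasurable_fst := (measurable_initialSegment hX n).aemeasurable
  aemeasurable_snd := (measurable_initialSegment hX' n).aemeasurable
  map_eq := by
    refine Measure.ext_of_singleton fun y => ?_
    rw [Measure.map_apply (measurable_initialSegment hX n) (measurableSet_singleton y),
      Measure.map_apply (measurable_initialSegment hX' n) (measurableSet_singleton y),
      ← measureReal_eq_measureReal_iff]
    exact hX.measureReal_initialSegment_eq hX' n y

lemma IsMarkovChain.integral_initialSegment (hX : IsMarkovChain μ μ₀ P X) (n : ℕ)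
    (F : (Fin (n + 1) → S) → ℝ) :
    ∫ ω, F (initialSegment X n ω) ∂μ = ∑ y, μ.real (initialSegment X n ⁻¹' {y}) * F y := by
  have hm := measurable_initialSegment hX n
  have := Measure.isProbabilityMeasure_map (μ := μ) hm.aemeasurable
  rw [← integral_map hm.aemeasurable (measurable_of_finite F).aestronglyMeasurable,
    integral_fintype .of_finite]
  simp [map_measureReal_apply hm (measurableSet_singleton _)]

/-- The Markov property, for expectations: given the path up to time `n`, a function of the
transition after time `n` may be averaged over the transition probabilities. -/
lemma IsMarkovChain.integral_initialSegment_mul (hX : IsMarkovChain μ μ₀ P X) (n : ℕ)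
    (F : (Fin (n + 1) → S) → ℝ) (φ : S → S → ℝ) :
    ∫ ω, F (initialSegment X n ω) * φ (X n ω) (X (n + 1) ω) ∂μ =
      ∫ ω, F (initialSegment X n ω) * ∑ s', P (X n ω) s' * φ (X n ω) s' ∂μ := by
  have h₁ := hX.integral_initialSegment (n + 1) fun z =>
    F (Fin.init z) * φ (z (Fin.last n).castSucc) (z (Fin.last (n + 1)))
  have h₂ := hX.integral_initialSegment n fun y =>
    F y * ∑ s', P (y (Fin.last n)) s' * φ (y (Fin.last n)) s'
  refine Eq.trans h₁ (Eq.trans ?_ h₂.symm)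
  rw [← (Fin.snocEquiv fun _ => S).sum_comp, Fintype.sum_prod_type_right]
  refine Finset.sum_congr rfl fun y _ => ?_
  simp only [Finset.mul_sum]
  refine Finset.sum_congr rfl fun b _ => ?_
  change μ.real (initialSegment X (n + 1) ⁻¹' {(Fin.snoc y b : Fin (n + 2) → S)}) *
    (F (Fin.init (Fin.snoc y b : Fin (n + 2) → S)) *
      φ ((Fin.snoc y b : Fin (n + 2) → S) (Fin.last n).castSucc)
        ((Fin.snoc y b : Fin (n + 2) → S) (Fin.last (n + 1)))) = _
  rw [hX.measureReal_initialSegment_snoc, Fin.init_snoc, Fin.snoc_castSucc, Fin.snoc_last]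
  ring

lemma IsMarkovChain.integral_apply [DecidableEq S] (hX : IsMarkovChain μ μ₀ P X) (n : ℕ)
    (f : S → ℝ) :
    ∫ ω, f (X n ω) ∂μ = μ₀ ⬝ᵥ (P ^ n *ᵥ f) := by
  induction n generalizing f with
  | zero =>
    refine (hX.integral_initialSegment 0 fun y => f (y 0)).trans ?_
    simp only [hX.measureReal_initialSegment_zero, pow_zero, Matrix.one_mulVec, dotProduct]
    exact (Equiv.funUnique (Fin 1) S).sum_comp fun s => μ₀ s * f s
  | succ n ih =>
    have h := hX.integral_initialSegment_mul n (fun _ => 1) fun _ s' => f s'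
    simp only [one_mul] at h
    rw [h, pow_succ, ← Matrix.mulVec_mulVec, ← ih]
    rfl

lemma IsMarkovChain.integral_transition [DecidableEq S] (hX : IsMarkovChain μ μ₀ P X) (n : ℕ)
    (φ : S → S → ℝ) :
    ∫ ω, φ (X n ω) (X (n + 1) ω) ∂μ = μ₀ ⬝ᵥ (P ^ n *ᵥ fun s => ∑ s', P s s' * φ s s') := by
  rw [← hX.integral_apply]
  simpa using hX.integral_initialSegment_mul n (fun _ => 1) φ

/-- Functions of the transitions with vanishing conditional mean are orthogonal. -/
lemma IsMarkovChain.integral_mul_eq_zero (hX : IsMarkovChain μ μ₀ P X) {ψ : S → S → ℝ}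
    (hψ : ∀ s, ∑ s', P s s' * ψ s s' = 0) {j k : ℕ} (hjk : j < k) :
    ∫ ω, ψ (X j ω) (X (j + 1) ω) * ψ (X k ω) (X (k + 1) ω) ∂μ = 0 := by
  have h := hX.integral_initialSegment_mul k
    (fun y => ψ (y ⟨j, by omega⟩) (y ⟨j + 1, by omega⟩)) ψ
  simpa [hψ, initialSegment] using h

end Paths

end FiniteChain

/-! ### A strong law for bounded orthogonal random variables -/

section StrongLaw

variable {Ω : Type*} [MeasurableSpace Ω] {μ : Measure Ω} [IsProbabilityMeasure μ]
  {D : ℕ → Ω → ℝ} {K : ℝ}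

lemma integral_sq_sum_le_of_orthogonal (hm : ∀ k, Measurable (D k)) (hK : ∀ k ω, |D k ω| ≤ K)
    (horth : ∀ j k, j < k → ∫ ω, D j ω * D k ω ∂μ = 0) (n : ℕ) :
    ∫ ω, (∑ k ∈ Finset.range n, D k ω) ^ 2 ∂μ ≤ n * K ^ 2 := by
  have hsq : ∀ ω, (∑ k ∈ Finset.range n, D k ω) ^ 2 =
      ∑ j ∈ Finset.range n, ∑ k ∈ Finset.range n, D j ω * D k ω := fun ω => by
    rw [sq, Finset.sum_mul_sum]
  have hint : ∀ j k, Integrable (fun ω => D j ω * D k ω) μ := fun j k =>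
    .of_bound ((hm j).mul (hm k)).aestronglyMeasurable (K * K) (.of_forall fun ω => by
      rw [Real.norm_eq_abs, abs_mul]
      exact mul_le_mul (hK j ω) (hK k ω) (abs_nonneg _) ((abs_nonneg _).trans (hK j ω)))
  simp_rw [hsq]
  rw [integral_finsetSum _ fun j _ => integrable_finsetSum _ fun k _ => hint j k]
  calc ∑ j ∈ Finset.range n, ∫ ω, ∑ k ∈ Finset.range n, D j ω * D k ω ∂μ
      = ∑ j ∈ Finset.range n, ∫ ω, D j ω * D j ω ∂μ := by
        refine Finset.sum_congr rfl fun j hj => ?_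
        rw [integral_finsetSum _ fun k _ => hint j k]
        refine Finset.sum_eq_single_of_mem j hj fun k _ hkj => ?_
        rcases lt_or_gt_of_ne hkj with h | h
        · simpa only [mul_comm] using horth k j h
        · exact horth j k h
    _ ≤ ∑ j ∈ Finset.range n, K ^ 2 := by
        refine Finset.sum_le_sum fun j _ => ?_
        calc ∫ ω, D j ω * D j ω ∂μ ≤ ∫ _, K ^ 2 ∂μ :=
              integral_mono (hint j j) (integrable_const _) fun ω => by
                rw [← sq]
                exact sq_le_sq' (abs_le.1 (hK j ω)).1 (abs_le.1 (hK j ω)).2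
          _ = K ^ 2 := by simp
    _ = n * K ^ 2 := by simp

/-- Averages of a bounded sequence tend to zero if they do so along the squares: between `q ^ 2`
and `(q + 1) ^ 2` a partial sum changes by at most `2 * q * K`. -/
lemma tendsto_average_of_tendsto_average_sq {d : ℕ → ℝ} (hK : ∀ k, |d k| ≤ K)
    (h : Tendsto (fun q : ℕ => (∑ k ∈ Finset.range (q ^ 2), d k) / (q : ℝ) ^ 2) atTop (𝓝 0)) :
    Tendsto (fun n : ℕ => (∑ k ∈ Finset.range n, d k) / (n : ℝ)) atTop (𝓝 0) := by
  have hsqrt : Tendsto Nat.sqrt atTop atTop :=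
    tendsto_atTop_mono' _ (Eventually.of_forall fun _ => le_rfl)
      (tendsto_atTop_atTop.2 fun b => ⟨b * b, fun a ha => Nat.le_sqrt.2 ha⟩)
  have hbound : Tendsto (fun q : ℕ => |(∑ k ∈ Finset.range (q ^ 2), d k) / (q : ℝ) ^ 2| +
      2 * K / q) atTop (𝓝 0) := by
    simpa using h.abs.add (tendsto_const_div_atTop_nhds_zero_nat (2 * K))
  refine squeeze_zero_norm' ?_ (hbound.comp hsqrt)
  filter_upwards [eventually_gt_atTop 0] with n hn
  have hK₀ : 0 ≤ K := (abs_nonneg _).trans (hK 0)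
  set q := n.sqrt with hq
  have hq₀ : 0 < q := Nat.sqrt_pos.2 hn
  have hqn : q ^ 2 ≤ n := Nat.sqrt_le' n
  have hnq : n ≤ q ^ 2 + 2 * q := by
    have := Nat.sqrt_le_add n
    rw [← hq] at this
    nlinarith
  have hqR : (0 : ℝ) < q := by exact_mod_cast hq₀
  have hnR : (0 : ℝ) < n := by exact_mod_cast hn
  have hqnR : (q : ℝ) ^ 2 ≤ n := by exact_mod_cast hqn
  have hdiff : |(∑ k ∈ Finset.range n, d k) - ∑ k ∈ Finset.range (q ^ 2), d k| ≤ 2 * q * K := by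
    rw [← Finset.sum_Ico_eq_sub _ hqn]
    calc |∑ k ∈ Finset.Ico (q ^ 2) n, d k| ≤ ∑ k ∈ Finset.Ico (q ^ 2) n, K :=
          (Finset.abs_sum_le_sum_abs _ _).trans (Finset.sum_le_sum fun k _ => hK k)
      _ = ((n - q ^ 2 : ℕ) : ℝ) * K := by simp
      _ ≤ 2 * q * K := by
          refine mul_le_mul_of_nonneg_right ?_ hK₀
          exact_mod_cast (by omega : n - q ^ 2 ≤ 2 * q)
  have htri : |∑ k ∈ Finset.range n, d k| ≤ |∑ k ∈ Finset.range (q ^ 2), d k| + 2 * q * K := by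
    have := abs_sub_abs_le_abs_sub (∑ k ∈ Finset.range n, d k) (∑ k ∈ Finset.range (q ^ 2), d k)
    linarith
  simp only [Function.comp_apply, Real.norm_eq_abs, abs_div, abs_of_pos hnR, ← hq,
    abs_of_pos (pow_pos hqR 2)]
  calc |∑ k ∈ Finset.range n, d k| / n
      ≤ (|∑ k ∈ Finset.range (q ^ 2), d k| + 2 * q * K) / (q : ℝ) ^ 2 :=
        div_le_div₀ (by positivity) htri (pow_pos hqR 2) hqnR
    _ = |∑ k ∈ Finset.range (q ^ 2), d k| / (q : ℝ) ^ 2 + 2 * K / q := by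
        field_simp

/-- The strong law of large numbers for bounded orthogonal random variables. Along the squares the
second moments of the averages are summable. -/
lemma ae_tendsto_average_of_orthogonal (hm : ∀ k, Measurable (D k)) (hK : ∀ k ω, |D k ω| ≤ K)
    (horth : ∀ j k, j < k → ∫ ω, D j ω * D k ω ∂μ = 0) :
    ∀ᵐ ω ∂μ, Tendsto (fun n : ℕ => (∑ k ∈ Finset.range n, D k ω) / (n : ℝ)) atTop (𝓝 0) := by
  let A : ℕ → Ω → ℝ := fun q ω => (∑ k ∈ Finset.range (q ^ 2), D k ω) / (q : ℝ) ^ 2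
  have hAm : ∀ q, Measurable (A q) := fun q =>
    (Finset.measurable_fun_sum _ fun k _ => hm k).div_const _
  have hAK : ∀ q ω, |A q ω| ≤ K := fun q ω => by
    have hK₀ : 0 ≤ K := (abs_nonneg _).trans (hK 0 ω)
    rw [abs_div, abs_of_nonneg (by positivity : (0 : ℝ) ≤ (q : ℝ) ^ 2)]
    refine div_le_of_le_mul₀ (by positivity) hK₀ ((Finset.abs_sum_le_sum_abs _ _).trans ?_)
    calc ∑ k ∈ Finset.range (q ^ 2), |D k ω| ≤ ∑ k ∈ Finset.range (q ^ 2), K :=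
          Finset.sum_le_sum fun k _ => hK k ω
      _ = K * (q : ℝ) ^ 2 := by simp [mul_comm]
  have hAint : ∀ q, Integrable (fun ω => A q ω ^ 2) μ := fun q =>
    .of_bound ((hAm q).pow_const 2).aestronglyMeasurable (K ^ 2) (.of_forall fun ω => by
      rw [Real.norm_eq_abs, abs_pow]
      exact pow_le_pow_left₀ (abs_nonneg _) (hAK q ω) 2)
  have hmom : ∀ q : ℕ, ∫ ω, A q ω ^ 2 ∂μ ≤ K ^ 2 * (1 / (q : ℝ) ^ 2) := fun q => by
    rcases Nat.eq_zero_or_pos q with rfl | hq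
    · simp [A]
    have hqR : (0 : ℝ) < q := by exact_mod_cast hq
    have h := integral_sq_sum_le_of_orthogonal hm hK horth (q ^ 2)
    simp only [A, div_pow]
    rw [integral_div, div_le_iff₀ (by positivity)]
    refine h.trans (le_of_eq ?_)
    push_cast
    field_simp
  have hsum : Summable fun q : ℕ => K ^ 2 * (1 / (q : ℝ) ^ 2) :=
    (Real.summable_one_div_nat_pow.2 one_lt_two).mul_left _
  have hfin : ∑' q, ∫⁻ ω, ENNReal.ofReal (A q ω ^ 2) ∂μ ≠ ⊤ := by
    refine ne_top_of_le_ne_top hsum.tsum_ofReal_ne_top (ENNReal.tsum_le_tsum fun q => ?_)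
    rw [← ofReal_integral_eq_lintegral_ofReal (hAint q) (.of_forall fun ω => sq_nonneg _)]
    exact ENNReal.ofReal_le_ofReal (hmom q)
  have hmeas : ∀ q, Measurable fun ω => ENNReal.ofReal (A q ω ^ 2) := fun q =>
    ((hAm q).pow_const 2).ennreal_ofReal
  rw [← lintegral_tsum fun q => (hmeas q).aemeasurable] at hfin
  filter_upwards [ae_lt_top (Measurable.tsum hmeas) hfin] with ω hω
  refine tendsto_average_of_tendsto_average_sq (fun k => hK k ω) ?_
  have h₀ := ENNReal.tendsto_atTop_zero_of_tsum_ne_top hω.ne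
  have h₁ : Tendsto (fun q => A q ω ^ 2) atTop (𝓝 0) := by
    simpa [Function.comp_def, ENNReal.toReal_ofReal (sq_nonneg _)] using
      (ENNReal.tendsto_toReal ENNReal.zero_ne_top).comp h₀
  exact squeeze_zero_norm (fun q => by rw [Real.norm_eq_abs, ← Real.sqrt_sq_eq_abs])
    (by simpa using h₁.sqrt)

end StrongLaw

/-! ### Normalizing sums of `n + 1` terms by `n` -/

section Averages

lemma tendsto_natCast_add_one_div_self :
    Tendsto (fun n : ℕ => ((n : ℝ) + 1) / n) atTop (𝓝 1) := by
  have h : Tendsto (fun n : ℕ => 1 + 1 / (n : ℝ)) atTop (𝓝 1) := by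
    simpa using tendsto_const_nhds.add (tendsto_const_div_atTop_nhds_zero_nat (1 : ℝ))
  refine h.congr' ?_
  filter_upwards [eventually_ne_atTop 0] with n hn
  have hn' : (n : ℝ) ≠ 0 := by exact_mod_cast hn
  field_simp

lemma tendsto_one_div_mul_sum_range_succ {d : ℕ → ℝ} {c : ℝ}
    (h : Tendsto (fun n : ℕ => (∑ k ∈ Finset.range n, d k) / (n : ℝ)) atTop (𝓝 c)) :
    Tendsto (fun n : ℕ => 1 / (n : ℝ) * ∑ k ∈ Finset.range (n + 1), d k) atTop (𝓝 c) := by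
  have h' := tendsto_natCast_add_one_div_self.mul ((tendsto_add_atTop_iff_nat 1).2 h)
  rw [one_mul] at h'
  refine h'.congr fun n => ?_
  have hn : (n : ℝ) + 1 ≠ 0 := by positivity
  push_cast
  field_simp

end Averages

namespace FiniteChain

/-! ### The ergodic theorem for time averages -/

section TimeAverage

variable {S : Type*} [Fintype S] [DecidableEq S]

lemma exists_abs_le_of_finite {ι : Type*} [Finite ι] (f : ι → ℝ) : ∃ K, ∀ i, |f i| ≤ K := by
  obtain ⟨K, hK⟩ := (Set.finite_range fun i => |f i|).bddAbove
  exact ⟨K, fun i => hK ⟨i, rfl⟩⟩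

/-- The truncated Green function `∑ i < m, P ^ i f`, which solves the Poisson equation up to the
error `P ^ m f`. -/
def truncatedGreen (P : Matrix S S ℝ) (f : S → ℝ) (m : ℕ) : S → ℝ :=
  ∑ i ∈ Finset.range m, P ^ i *ᵥ f

lemma truncatedGreen_sub_mulVec (P : Matrix S S ℝ) (f : S → ℝ) (m : ℕ) :
    truncatedGreen P f m - P *ᵥ truncatedGreen P f m = f - P ^ m *ᵥ f := by
  have h : P *ᵥ truncatedGreen P f m = ∑ i ∈ Finset.range m, P ^ (i + 1) *ᵥ f := by
    simp only [truncatedGreen, Matrix.mulVec_sum, Matrix.mulVec_mulVec, pow_succ']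
  rw [h, truncatedGreen, ← Finset.sum_sub_distrib,
    Finset.sum_range_sub' (fun i => P ^ i *ᵥ f) m, pow_zero, Matrix.one_mulVec]

/-- The transition function `φ`, centred by its conditional mean and corrected by the increment of
the truncated Green function of that conditional mean, again centred. -/
def correctedReward (P : Matrix S S ℝ) (φ : S → S → ℝ) (m : ℕ) (s s' : S) : ℝ :=
  φ s s' - (∑ a, P s a * φ s a) + truncatedGreen P (fun b => ∑ a, P b a * φ b a) m s' -
    (P *ᵥ truncatedGreen P (fun b => ∑ a, P b a * φ b a) m) s

lemma sum_mul_correctedReward {P : Matrix S S ℝ} (hP : P ∈ Matrix.rowStochastic ℝ S)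
    (φ : S → S → ℝ) (m : ℕ) (s : S) : ∑ s', P s s' * correctedReward P φ m s s' = 0 := by
  simp only [correctedReward, mul_sub, mul_add, Finset.sum_sub_distrib, Finset.sum_add_distrib,
    ← Finset.sum_mul, Matrix.sum_row_of_mem_rowStochastic hP, Matrix.mulVec, dotProduct]
  ring

/-- Along any path the corrected rewards differ from the rewards by `P ^ m` applied to the
conditional mean reward and by a telescoping term. -/
lemma sum_range_eq_sum_correctedReward (P : Matrix S S ℝ) (φ : S → S → ℝ) (m : ℕ) (x : ℕ → S)
    (n : ℕ) :
    ∑ k ∈ Finset.range n, φ (x k) (x (k + 1)) =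
      (∑ k ∈ Finset.range n, correctedReward P φ m (x k) (x (k + 1))) +
      (∑ k ∈ Finset.range n, (P ^ m *ᵥ fun s => ∑ a, P s a * φ s a) (x k)) +
      (truncatedGreen P (fun s => ∑ a, P s a * φ s a) m (x 0) -
        truncatedGreen P (fun s => ∑ a, P s a * φ s a) m (x n)) := by
  induction n with
  | zero => simp
  | succ n ih =>
    have h := congrFun (truncatedGreen_sub_mulVec P (fun s => ∑ a, P s a * φ s a) m) (x n)
    simp only [Pi.sub_apply] at h
    rw [Finset.sum_range_succ, Finset.sum_range_succ, Finset.sum_range_succ, ih]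
    simp only [correctedReward]
    linarith

variable {P : Matrix S S ℝ} {π : S → ℝ}

/-- If the corrected rewards along a path average out, the rewards have the time average that
`P ^ m` applied to the conditional mean reward tends to. -/
lemma tendsto_average_of_correctedReward
    (hπ : ∀ s s', Tendsto (fun n => (P ^ n) s s') atTop (𝓝 (π s'))) (φ : S → S → ℝ) {x : ℕ → S}
    (hx : ∀ m, Tendsto (fun n : ℕ =>
      (∑ k ∈ Finset.range n, correctedReward P φ m (x k) (x (k + 1))) / (n : ℝ)) atTop (𝓝 0)) :
    Tendsto (fun n : ℕ => (∑ k ∈ Finset.range n, φ (x k) (x (k + 1))) / (n : ℝ)) atTop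
      (𝓝 (π ⬝ᵥ fun s => ∑ s', P s s' * φ s s')) := by
  set f : S → ℝ := fun s => ∑ s', P s s' * φ s s'
  set c := π ⬝ᵥ f
  rw [Metric.tendsto_atTop']
  intro ε hε
  have hunif : ∀ᶠ m in atTop, ∀ s, |(P ^ m *ᵥ f) s - c| < ε / 3 :=
    eventually_all.2 fun s => by
      simpa [Real.dist_eq] using
        (Metric.tendsto_nhds.1 (tendsto_pow_mulVec hπ f s)) (ε / 3) (by positivity)
  obtain ⟨m, hm⟩ := hunif.exists
  obtain ⟨H, hH⟩ := exists_abs_le_of_finite (truncatedGreen P f m)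
  have h₁ : ∀ᶠ n : ℕ in atTop,
      |(∑ k ∈ Finset.range n, correctedReward P φ m (x k) (x (k + 1))) / (n : ℝ)| < ε / 3 := by
    simpa only [Real.dist_eq, sub_zero] using
      (Metric.tendsto_nhds.1 (hx m)) (ε / 3) (by positivity)
  have h₂ : ∀ᶠ n : ℕ in atTop, 2 * H / (n : ℝ) < ε / 3 :=
    (tendsto_const_div_atTop_nhds_zero_nat (2 * H)).eventually (gt_mem_nhds (by positivity))
  obtain ⟨N, hN⟩ := eventually_atTop.1 ((h₁.and h₂).and (eventually_gt_atTop 0))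
  refine ⟨N, fun n hn => ?_⟩
  obtain ⟨⟨hψ, hG⟩, hpos⟩ := hN n hn.le
  have hnR : (0 : ℝ) < n := by exact_mod_cast hpos
  have h₃ : |(∑ k ∈ Finset.range n, ((P ^ m *ᵥ f) (x k) - c)) / (n : ℝ)| ≤ ε / 3 := by
    rw [abs_div, abs_of_pos hnR, div_le_iff₀ hnR]
    calc |∑ k ∈ Finset.range n, ((P ^ m *ᵥ f) (x k) - c)| ≤ ∑ k ∈ Finset.range n, ε / 3 :=
          (Finset.abs_sum_le_sum_abs _ _).trans (Finset.sum_le_sum fun k _ => (hm _).le)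
      _ = ε / 3 * n := by simp [mul_comm]
  have h₄ : |(truncatedGreen P f m (x 0) - truncatedGreen P f m (x n)) / (n : ℝ)| ≤
      2 * H / n := by
    rw [abs_div, abs_of_pos hnR]
    refine div_le_div_of_nonneg_right ((abs_sub _ _).trans ?_) hnR.le
    linarith [hH (x 0), hH (x n)]
  have hsplit : (∑ k ∈ Finset.range n, φ (x k) (x (k + 1))) / (n : ℝ) - c =
      (∑ k ∈ Finset.range n, correctedReward P φ m (x k) (x (k + 1))) / (n : ℝ) +
      (∑ k ∈ Finset.range n, ((P ^ m *ᵥ f) (x k) - c)) / (n : ℝ) +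
      (truncatedGreen P f m (x 0) - truncatedGreen P f m (x n)) / (n : ℝ) := by
    rw [sum_range_eq_sum_correctedReward P φ m x n, Finset.sum_sub_distrib, Finset.sum_const,
      Finset.card_range, nsmul_eq_mul]
    field_simp
    ring
  rw [Real.dist_eq, hsplit]
  refine lt_of_le_of_lt (abs_add_three _ _ _) ?_
  linarith

/-- The ergodic theorem for a function of the transitions of a finite chain. -/
lemma IsMarkovChain.ae_tendsto_average [MeasurableSpace S] [MeasurableSingletonClass S]
    {Ω : Type*} [MeasurableSpace Ω] {μ : Measure Ω} [IsProbabilityMeasure μ] {μ₀ : S → ℝ}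
    {X : ℕ → Ω → S} (hX : IsMarkovChain μ μ₀ P X) (hP : P ∈ Matrix.rowStochastic ℝ S)
    (hπ : ∀ s s', Tendsto (fun n => (P ^ n) s s') atTop (𝓝 (π s'))) (φ : S → S → ℝ) :
    ∀ᵐ ω ∂μ, Tendsto
      (fun n : ℕ => (∑ k ∈ Finset.range n, φ (X k ω) (X (k + 1) ω)) / (n : ℝ)) atTop
      (𝓝 (π ⬝ᵥ fun s => ∑ s', P s s' * φ s s')) := by
  have h : ∀ m, ∀ᵐ ω ∂μ, Tendsto (fun n : ℕ =>
      (∑ k ∈ Finset.range n, correctedReward P φ m (X k ω) (X (k + 1) ω)) / (n : ℝ)) atTop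
      (𝓝 0) := fun m => by
    obtain ⟨K, hK⟩ := exists_abs_le_of_finite fun p : S × S => correctedReward P φ m p.1 p.2
    refine ae_tendsto_average_of_orthogonal
      (D := fun k ω => correctedReward P φ m (X k ω) (X (k + 1) ω)) (K := K)
      (fun k => ?_) (fun k ω => hK (X k ω, X (k + 1) ω))
      fun j k hjk => hX.integral_mul_eq_zero (sum_mul_correctedReward hP φ m) hjk
    exact (measurable_of_finite fun p : S × S => correctedReward P φ m p.1 p.2).comp
      ((hX.measurable k).prodMk (hX.measurable (k + 1)))
  filter_upwards [ae_all_iff.2 h] with ω hω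
  exact tendsto_average_of_correctedReward hπ φ hω

end TimeAverage

end FiniteChain

/-! ### Ensemble averages -/

section Ensemble

variable {Ω : Type*} [MeasurableSpace Ω] {μ : Measure Ω} [IsProbabilityMeasure μ]

/-- A weak law of large numbers that is uniform in the time `t`: by Chebyshev's inequality the
deviation probability of the ensemble average is controlled by a variance bound that does not
depend on `t`. -/
lemma tendstoInMeasure_ensembleAverage {r : ℕ → ℕ → Ω → ℝ} {K ρ : ℝ} {e : ℕ → ℝ}
    (hm : ∀ j t, Measurable (r j t)) (hK : ∀ j t ω, |r j t ω| ≤ K)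
    (hindep : ∀ t, Pairwise fun i j => r i t ⟂ᵢ[μ] r j t)
    (hmean : ∀ j t, ∫ ω, r j t ω ∂μ = e t) (he : Tendsto e atTop (𝓝 ρ)) :
    TendstoInMeasure μ (fun (p : ℕ × ℕ) ω => ensembleAverage r p.1 p.2 ω) (atTop ×ˢ atTop)
      (fun _ => ρ) := by
  have hL : ∀ j t, MemLp (r j t) 2 μ := fun j t =>
    .of_bound (hm j t).aestronglyMeasurable K (.of_forall (hK j t))
  have hAL : ∀ N t, MemLp (ensembleAverage r N t) 2 μ := fun N t =>
    (memLp_finsetSum _ fun j _ => hL j t).const_mul _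
  -- At `N = 0` both sides of the next two statements vanish, as division by zero gives zero.
  have hAmean : ∀ N t, ∫ ω, ensembleAverage r N t ω ∂μ = ((N : ℝ) + 1) / N * e t := fun N t => by
    simp only [ensembleAverage]
    rw [integral_const_mul, integral_finsetSum _ fun j _ => (hL j t).integrable one_le_two]
    simp [hmean]
    ring
  have hAvar : ∀ N t, variance (ensembleAverage r N t) μ ≤
      ((N : ℝ) + 1) / N * (K ^ 2 / N) := fun N t => by
    have hone : ∀ j, variance (r j t) μ ≤ K ^ 2 := fun j => by
      have h := variance_le_sq_of_bounded (μ := μ) (a := -K) (b := K) (X := r j t)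
        (.of_forall fun ω => abs_le.1 (hK j t ω)) (hm j t).aemeasurable
      refine h.trans (le_of_eq ?_)
      ring
    have hsum : variance (fun ω => ∑ j ∈ Finset.range (N + 1), r j t ω) μ ≤
        ((N : ℝ) + 1) * K ^ 2 := by
      have h := IndepFun.variance_sum (s := Finset.range (N + 1)) (fun j _ => hL j t)
        ((hindep t).set_pairwise _)
      rw [← Finset.sum_fn, h]
      refine (Finset.sum_le_sum fun j _ => hone j).trans (le_of_eq ?_)
      simp
    calc variance (ensembleAverage r N t) μ
        = (1 / (N : ℝ)) ^ 2 * variance (fun ω => ∑ j ∈ Finset.range (N + 1), r j t ω) μ :=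
          variance_const_mul _ _ _
      _ ≤ (1 / (N : ℝ)) ^ 2 * (((N : ℝ) + 1) * K ^ 2) :=
          mul_le_mul_of_nonneg_left hsum (sq_nonneg _)
      _ = ((N : ℝ) + 1) / N * (K ^ 2 / N) := by ring
  have hmean_tendsto : Tendsto (fun p : ℕ × ℕ => ((p.1 : ℝ) + 1) / p.1 * e p.2)
      (atTop ×ˢ atTop) (𝓝 ρ) := by
    simpa using (tendsto_natCast_add_one_div_self.comp tendsto_fst).mul (he.comp tendsto_snd)
  have hvar_tendsto : Tendsto (fun N : ℕ => ((N : ℝ) + 1) / N * (K ^ 2 / N)) atTop (𝓝 0) := by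
    simpa using tendsto_natCast_add_one_div_self.mul (tendsto_const_div_atTop_nhds_zero_nat (K ^ 2))
  rw [tendstoInMeasure_iff_dist]
  intro ε hε
  have hbound : Tendsto (fun p : ℕ × ℕ =>
      ENNReal.ofReal (((p.1 : ℝ) + 1) / p.1 * (K ^ 2 / p.1) / (ε / 2) ^ 2)) (atTop ×ˢ atTop)
      (𝓝 0) := by
    simpa using ENNReal.tendsto_ofReal ((hvar_tendsto.comp tendsto_fst).div_const ((ε / 2) ^ 2))
  refine tendsto_of_tendsto_of_tendsto_of_le_of_le' tendsto_const_nhds hbound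
    (.of_forall fun _ => zero_le) ?_
  filter_upwards [Metric.tendsto_nhds.1 hmean_tendsto (ε / 2) (by positivity)] with p hp
  calc μ {ω | ε ≤ dist (ensembleAverage r p.1 p.2 ω) ρ}
      ≤ μ {ω | ε / 2 ≤
          |ensembleAverage r p.1 p.2 ω - ∫ ω', ensembleAverage r p.1 p.2 ω' ∂μ|} := by
        refine measure_mono fun ω hω => ?_
        rw [Set.mem_ofPred_eq] at hω ⊢
        rw [hAmean, ← Real.dist_eq]
        linarith [dist_triangle (ensembleAverage r p.1 p.2 ω)
          (((p.1 : ℝ) + 1) / p.1 * e p.2) ρ]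
    _ ≤ ENNReal.ofReal (variance (ensembleAverage r p.1 p.2) μ / (ε / 2) ^ 2) :=
        meas_ge_le_variance_div_sq (hAL _ _) (by positivity)
    _ ≤ _ := ENNReal.ofReal_le_ofReal
        (div_le_div_of_nonneg_right (hAvar _ _) (by positivity))

end Ensemble

/-! ### Rewards along independent trajectories -/

namespace MarkovRewardProcess

variable {S : Type*} [Fintype S] [DecidableEq S] {M : MarkovRewardProcess S}
  {Ω : Type*} {X : ℕ → ℕ → Ω → S}

lemma meanReward_eq_dotProduct (M : MarkovRewardProcess S) (π : S → ℝ) :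
    M.meanReward π = π ⬝ᵥ fun s => ∑ s', M.P s s' * M.g s s' := by
  simp only [meanReward, dotProduct, Finset.mul_sum, mul_assoc]

variable [MeasurableSpace S] [MeasurableSingletonClass S] [MeasurableSpace Ω] {μ : Measure Ω}
  {μ₀ : S → ℝ}

lemma measurable_reward (hX : ∀ j, FiniteChain.IsMarkovChain μ μ₀ M.P (X j)) (j t : ℕ) :
    Measurable (M.reward X j t) :=
  (measurable_of_finite fun p : S × S => M.g p.1 p.2).comp
    (((hX j).measurable t).prodMk ((hX j).measurable (t + 1)))

lemma pairwise_indepFun_reward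
    (hindep : iIndepFun (fun (j : ℕ) (ω : Ω) (t : ℕ) => X j t ω) μ) (t : ℕ) :
    Pairwise fun i j => M.reward X i t ⟂ᵢ[μ] M.reward X j t := fun i j hij => by
  have hpair : Measurable fun x : ℕ → S => (x t, x (t + 1)) := by fun_prop
  have hm : Measurable fun x : ℕ → S => M.g (x t) (x (t + 1)) :=
    (measurable_of_finite fun p : S × S => M.g p.1 p.2).comp hpair
  exact (hindep.indepFun hij).comp hm hm

variable [IsProbabilityMeasure μ]

lemma identDistrib_reward (hX : ∀ j, FiniteChain.IsMarkovChain μ μ₀ M.P (X j)) (i j t : ℕ) :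
    IdentDistrib (M.reward X i t) (M.reward X j t) μ μ :=
  ((hX i).identDistrib_initialSegment (hX j) (t + 1)).comp (measurable_of_finite
    fun y : Fin (t + 2) → S => M.g (y (Fin.last t).castSucc) (y (Fin.last (t + 1))))

/-- The strong law of large numbers across trajectories, at a fixed time. -/
lemma ae_tendsto_ensembleAverage (hX : ∀ j, FiniteChain.IsMarkovChain μ μ₀ M.P (X j))
    (hindep : iIndepFun (fun (j : ℕ) (ω : Ω) (t : ℕ) => X j t ω) μ) (t : ℕ) :
    ∀ᵐ ω ∂μ, Tendsto (fun N => ensembleAverage (M.reward X) N t ω) atTop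
      (𝓝 (∫ ω, M.reward X 0 t ω ∂μ)) := by
  obtain ⟨K, hK⟩ := FiniteChain.exists_abs_le_of_finite fun p : S × S => M.g p.1 p.2
  have hint : Integrable (M.reward X 0 t) μ :=
    .of_bound (measurable_reward hX 0 t).aestronglyMeasurable K
      (.of_forall fun ω => hK (X 0 t ω, X 0 (t + 1) ω))
  filter_upwards [strong_law_ae_real (fun j => M.reward X j t) hint
    (pairwise_indepFun_reward hindep t) fun j => identDistrib_reward hX j 0 t] with ω hω
  exact tendsto_one_div_mul_sum_range_succ hω

lemma tendsto_integral_reward (hX : ∀ j, FiniteChain.IsMarkovChain μ μ₀ M.P (X j))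
    (hμ₀ : ∑ s, μ₀ s = 1) {π : S → ℝ}
    (hπ : ∀ s s', Tendsto (fun n => (M.P ^ n) s s') atTop (𝓝 (π s'))) (j : ℕ) :
    Tendsto (fun t => ∫ ω, M.reward X j t ω ∂μ) atTop (𝓝 (M.meanReward π)) := by
  simp only [reward, fun t => (hX j).integral_transition t M.g, meanReward_eq_dotProduct,
    Matrix.dotProduct_mulVec]
  exact tendsto_finsetSum _ fun s _ =>
    (FiniteChain.tendsto_vecMul_pow hπ hμ₀ s).mul_const _

lemma ae_tendsto_timeAverage (hX : ∀ j, FiniteChain.IsMarkovChain μ μ₀ M.P (X j)) {π : S → ℝ}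
    (hπ : ∀ s s', Tendsto (fun n => (M.P ^ n) s s') atTop (𝓝 (π s'))) (i : ℕ) :
    ∀ᵐ ω ∂μ, Tendsto (fun T => timeAverage (M.reward X) i T ω) atTop (𝓝 (M.meanReward π)) := by
  rw [meanReward_eq_dotProduct]
  filter_upwards [(hX i).ae_tendsto_average M.stochastic hπ M.g] with ω hω
  exact tendsto_one_div_mul_sum_range_succ hω

end MarkovRewardProcess

/-- Let `X 0, X 1, …` be independent trajectories of the chain of a finite Markov reward process, all
started from `μ₀`. If the chain is unichain and aperiodic, the reward process is asymptotically
ergodic, and the common value of the limits is the mean reward under the unique stationary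
distribution. The ensemble average also converges in probability as `N` and `t` tend to infinity
simultaneously. -/
theorem theorem2 {S : Type*} [Fintype S] [DecidableEq S] [MeasurableSpace S]
    [MeasurableSingletonClass S] (M : MarkovRewardProcess S)
    (huni : FiniteChain.IsUnichain M.P) (haper : FiniteChain.IsAperiodic M.P)
    (μ₀ : S → ℝ) (hμ₀ : μ₀ ∈ stdSimplex ℝ S)
    {Ω : Type*} [MeasurableSpace Ω] (μ : Measure Ω) [IsProbabilityMeasure μ]
    (X : ℕ → ℕ → Ω → S)
    (hchain : ∀ j, FiniteChain.IsMarkovChain μ μ₀ M.P (X j))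
    (hindep : iIndepFun (fun (j : ℕ) (ω : Ω) (t : ℕ) => X j t ω) μ) :
    IsAsymptoticallyErgodic μ (M.reward X) ∧
    ∃ π : S → ℝ, (FiniteChain.IsStationary M.P π ∧
        ∀ π', FiniteChain.IsStationary M.P π' → π' = π) ∧
      (∀ i, Tendsto (fun t => ∫ ω, M.reward X i t ω ∂μ) atTop (𝓝 (M.meanReward π))) ∧
      (∀ i, ∀ᵐ ω ∂μ, Tendsto (fun T => timeAverage (M.reward X) i T ω) atTop
        (𝓝 (M.meanReward π))) ∧
      TendstoInMeasure μ (fun (p : ℕ × ℕ) ω => ensembleAverage (M.reward X) p.1 p.2 ω)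
        (atTop ×ˢ atTop) (fun _ => M.meanReward π) := by
  have hne : Nonempty S := by
    by_contra h
    rw [not_nonempty_iff] at h
    simpa using hμ₀.2
  obtain ⟨π, hπ⟩ := FiniteChain.exists_tendsto_pow M.stochastic huni haper
  have hmean := MarkovRewardProcess.tendsto_integral_reward hchain hμ₀.2 hπ
  have htime := MarkovRewardProcess.ae_tendsto_timeAverage hchain hπ
  refine ⟨fun i => ?_, π, ⟨FiniteChain.isStationary_of_tendsto_pow M.stochastic hπ,
    fun π' h => h.eq_of_tendsto_pow hπ⟩, hmean, htime, ?_⟩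
  · filter_upwards [htime i, ae_all_iff.2 fun t =>
      MarkovRewardProcess.ae_tendsto_ensembleAverage (M := M) hchain hindep t] with ω h₁ h₂
    exact ⟨_, _, h₂, hmean 0, h₁⟩
  · obtain ⟨K, hK⟩ := FiniteChain.exists_abs_le_of_finite fun p : S × S => M.g p.1 p.2
    exact tendstoInMeasure_ensembleAverage (MarkovRewardProcess.measurable_reward hchain)
      (fun j t ω => hK (X j t ω, X j (t + 1) ω))
      (MarkovRewardProcess.pairwise_indepFun_reward hindep)
      (fun j t => (MarkovRewardProcess.identDistrib_reward hchain j 0 t).integral_eq) (hmean 0)
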